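/- Let $G$ be a finite simple graph with $m$ edges, let $P$ be a finite pattern graph with $k$ vertices, and let $C$ be the number of matches of $P$ in $G$, that is, of subgraphs (or, for vertex-induced matching, of induced subgraphs) of $G$ isomorphic to $P$. A neighbor sampling (NS) scheme draws one sampled count $X$ as follows. Draw an edge $e_1$ of $G$ uniformly at random and put $\alpha=m$. Then, $k-2$ times, draw a vertex uniformly at random from a candidate set, which is determined by the vertices drawn so far and contained in their neighborhood in $G$ (the whole neighborhood in basic NS, a part of it if pruning is used), and multiply $\alpha$ by the size $c_j$ of the candidate set; if a candidate set is empty, $X=0$. Every match $M$ is assigned exactly one sampling path on which it is reported: one of its edges followed by its remaining vertices in an order in which each of them lies in the corresponding candidate set. If the path drawn is the path of $h$ matches, then $X=h\alpha$ (so $X=0$ for a miss, and $X=\alpha$ for a hit of exactly one match). Let $X_1,X_2,\dots$ be independent samples drawn in this way, and assume that $X_1$ has positive variance (this forces $C>0$). Let $0<\delta<1$, let $\Phi$ be the cumulative distribution function of the standard normal distribution, and put $$\mu=\frac1n\sum_{i=1}^n X_i,\qquad \sigma=\sqrt{\frac1n\Bigl(\frac1n\sum_{i=1}^n X_i^2-\mu^2\Bigr)},\qquad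 \hat\epsilon=\frac{\Phi^{-1}(1-\frac{\delta}{2})\,\sigma}{\mu}.$$ (For $\mu=0$ put $\hat\epsilon=0$.) Then $$\mathbb P\left(\frac{|\mu-C|}{C}<\hat\epsilon\right)\longrightarrow 1-\delta\qquad\text{as } n\to\infty .$$ -/

import Mathlib

open MeasureTheory ProbabilityTheory Filter Topology

/-! Matches of a pattern in a data graph -/

/-- The two usual kinds of occurrence of a pattern in a graph. -/
inductive MatchKind where
  | edgeInduced
  | vertexInduced

/-- The matches of the pattern `P` in the data graph `G`: the subgraphs of `G` that are isomorphic
to `P`; for vertex-induced matching they have to be induced subgraphs of `G`. -/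
def patternMatches {V W : Type*} (G : SimpleGraph V) (P : SimpleGraph W) (kind : MatchKind) :
    Set G.Subgraph :=
  {M | Nonempty (P ≃g M.coe) ∧ (kind = MatchKind.vertexInduced → M.IsInduced)}

/-- The true count `C`: the number of matches of `P` in `G`. -/
noncomputable def trueCount {V W : Type*} (G : SimpleGraph V) (P : SimpleGraph W)
    (kind : MatchKind) : ℕ :=
  (patternMatches G P kind).ncard

/-! Neighbor sampling -/

/-- The neighborhood of a partial sample, which consists of the two ends of the first sampled edge
`e` and of the list `l` of the vertices sampled after it: all vertices that are adjacent in `G` to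
a vertex of the partial sample. -/
def sampleNeighborhood {V : Type*} (G : SimpleGraph V) (e : Sym2 V) (l : List V) : Set V :=
  {v | ∃ u, (u ∈ e ∨ u ∈ l) ∧ G.Adj u v}

/-- A neighbor sampling (NS) scheme for the pattern `P` in the data graph `G`.

`cand e l` is the set from which the next vertex is drawn when the first edge is `e` and the
vertices drawn after it are `l`. It is the whole neighborhood in basic NS, and a part of it when
pruning (matching order, symmetry breaking) is in force.

`first M` and `rest M` give the unique path of the search tree on which the match `M` is reported:
one of its edges, followed by its other vertices, each of which is a candidate when its turn comes
(the automorphism check: on every other path that leads to `M` it is discarded as redundant).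
The values of `first` and `rest` outside the matches play no role. -/
structure NSScheme {V W : Type*} (G : SimpleGraph V) (P : SimpleGraph W)
    (kind : MatchKind) where
  cand : Sym2 V → List V → Finset V
  cand_subset : ∀ e l, (cand e l : Set V) ⊆ sampleNeighborhood G e l
  first : G.Subgraph → Sym2 V
  rest : G.Subgraph → List V
  first_mem : ∀ M ∈ patternMatches G P kind, first M ∈ M.edgeSet
  rest_length : ∀ M ∈ patternMatches G P kind, (rest M).length = Nat.card W - 2
  mem_verts_iff : ∀ M ∈ patternMatches G P kind, ∀ v, v ∈ M.verts ↔ v ∈ first M ∨ v ∈ rest M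
  mem_cand : ∀ M ∈ patternMatches G P kind, ∀ l v l', rest M = l ++ v :: l' → v ∈ cand (first M) l

namespace NSScheme

variable {V W : Type*} {G : SimpleGraph V} {P : SimpleGraph W} {kind : MatchKind}

/-- The number of matches hit by the completed sample `(e, l)`; it is `0` for a miss. -/
noncomputable def hits (S : NSScheme G P kind) (e : Sym2 V) (l : List V) : ℕ :=
  {M ∈ patternMatches G P kind | S.first M = e ∧ S.rest M = l}.ncard

/-- The law of the sampled count when the first edge is `e`, the vertices `l` have been drawn, `α`
is the scaling factor so far, and `r` more vertices are to be drawn. Every vertex is drawn uniformly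
from the current candidate set and multiplies the scaling factor by the size of that set; if the
set is empty, the sample is a miss. A completed sample counts `α` for every match that it hits. -/
noncomputable def drawRest (S : NSScheme G P kind) (e : Sym2 V) : ℕ → List V → ℕ → PMF ℕ
  | 0, l, α => PMF.pure (α * S.hits e l)
  | r + 1, l, α =>
    if h : (S.cand e l).Nonempty then
      (PMF.uniformOfFinset (S.cand e l) h).bind
        fun v => S.drawRest e r (l ++ [v]) (α * (S.cand e l).card)
    else PMF.pure 0

/-- The law of one sampled count `X`: the first edge is drawn uniformly from the `m` edges of `G`,
with scaling factor `m`, and then vertices are drawn until the sample has as many vertices as the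
pattern. (The count is `0` if `G` has no edge.) -/
noncomputable def draw [Finite V] (S : NSScheme G P kind) : PMF ℕ :=
  if h : G.edgeSet.toFinite.toFinset.Nonempty then
    (PMF.uniformOfFinset G.edgeSet.toFinite.toFinset h).bind
      fun e => S.drawRest e (Nat.card W - 2) [] G.edgeSet.toFinite.toFinset.card
  else PMF.pure 0

end NSScheme

/-! The predicted error -/

/-- The cumulative distribution function `Φ` of the standard normal distribution. -/
noncomputable def stdNormalCDF (x : ℝ) : ℝ := cdf (gaussianReal 0 1) x

/-- The inverse `Φ⁻¹` of the (injective) function `Φ`; it is only used on the range `(0, 1)`. -/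
noncomputable def stdNormalInv : ℝ → ℝ := Function.invFun stdNormalCDF

/-- The mean `μ` of the first `n` sampled counts. -/
noncomputable def sampleMean (x : ℕ → ℝ) (n : ℕ) : ℝ :=
  (1 / (n : ℝ)) * ∑ i ∈ Finset.range n, x i

/-- The estimated standard deviation `σ` of the mean of the first `n` sampled counts. -/
noncomputable def sampleSigma (x : ℕ → ℝ) (n : ℕ) : ℝ :=
  √((1 / (n : ℝ)) * ((1 / (n : ℝ)) * ∑ i ∈ Finset.range n, x i ^ 2 - sampleMean x n ^ 2))

/-- The predicted relative error `Φ⁻¹(1 - δ / 2) σ / μ` after `n` samples. -/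
noncomputable def predictedError (δ : ℝ) (x : ℕ → ℝ) (n : ℕ) : ℝ :=
  stdNormalInv (1 - δ / 2) * sampleSigma x n / sampleMean x n

/-!
The sampled count `X` is an unbiased estimator of the true count `C`: a fixed match is reported on
one path only, and the scaling factor of a completed path is the reciprocal of the probability of
drawing that path. Formally, `NSScheme.natMean_drawRest` shows by induction on the number of
vertices still to be drawn that a partial sample with scaling factor `α` has expected count `α`
times the number of matches whose path extends it (`NSScheme.extensions`); pruning and empty
candidate sets do no harm, because the path of a match runs through candidates only.

The rest is asymptotic statistics for nonnegative i.i.d. variables with mean `C` and variance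
`s² > 0`. Let `μ` be the sample mean, `v` the empirical variance, so that `σ = √(v / n)`, and
`z = Φ⁻¹(1 - δ / 2)`. Clearing denominators turns the event `|μ - C| / C < z σ / μ` into
`|√n (μ - C)| μ - z C √v < 0` (`relError_lt_predictedError_iff`), which remains correct when `μ` or
`v` vanishes. By the central limit theorem, the strong law of large numbers for `μ` and `v`, and
Slutsky's theorem, the left-hand side converges in distribution to `s C (|N| - z)` with `N` standard
normal. The limit has no atom at `0`, so the portmanteau theorem gives the limiting probability
`ℙ(|N| < z) = 1 - δ` (`tendsto_measureReal_relError_lt`).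
-/

/-! ### Expectations of laws on the natural numbers -/

/-- The expectation of a law on `ℕ`, with values in `[0, ∞]`. -/
noncomputable def PMF.natMean (p : PMF ℕ) : ENNReal := ∑' n, p n * n

lemma PMF.natMean_pure (n : ℕ) : (PMF.pure n).natMean = n := by
  rw [PMF.natMean, tsum_eq_single n fun b hb => by simp [PMF.pure_apply, hb]]
  simp [PMF.pure_apply]

lemma PMF.natMean_bind {α : Type*} (p : PMF α) (f : α → PMF ℕ) :
    (p.bind f).natMean = ∑' a, p a * (f a).natMean := by
  simp only [PMF.natMean, PMF.bind_apply, ← ENNReal.tsum_mul_right, ← ENNReal.tsum_mul_left]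
  rw [ENNReal.tsum_comm]
  simp only [mul_assoc]

/-- Multiplying the scaling factor `c` by the number of choices compensates for the probability of
each choice, so that the conditional expectations `c * s.card * N a` add up without weights. -/
lemma PMF.natMean_uniformOfFinset_bind {α : Type*} (s : Finset α) (hs : s.Nonempty)
    (f : α → PMF ℕ) (c : ℕ) (N : α → ℕ)
    (h : ∀ a ∈ s, (f a).natMean = ((c * s.card * N a : ℕ) : ENNReal)) :
    ((PMF.uniformOfFinset s hs).bind f).natMean = ((c * ∑ a ∈ s, N a : ℕ) : ENNReal) := by
  have hc : (s.card : ENNReal) ≠ 0 := by simpa using hs.ne_empty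
  rw [PMF.natMean_bind, tsum_eq_sum (s := s) fun a ha => by
    rw [PMF.uniformOfFinset_apply_of_notMem hs ha, zero_mul]]
  push_cast
  rw [Finset.mul_sum]
  refine Finset.sum_congr rfl fun a ha => ?_
  rw [PMF.uniformOfFinset_apply_of_mem hs ha, h a ha]
  push_cast
  rw [mul_comm (c : ENNReal), mul_assoc, ← mul_assoc,
    ENNReal.inv_mul_cancel hc (ENNReal.natCast_ne_top _), one_mul]

lemma lintegral_natCast_eq_natMean {Ω : Type*} [MeasurableSpace Ω] {Pr : Measure Ω} {X : Ω → ℕ}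
    {p : PMF ℕ} (hX : HasLaw X p.toMeasure Pr) : ∫⁻ ω, (X ω : ENNReal) ∂Pr = p.natMean := by
  rw [hX.lintegral_comp (f := fun n : ℕ => (n : ENNReal)) (by fun_prop), lintegral_countable']
  refine tsum_congr fun n => ?_
  rw [PMF.toMeasure_apply_singleton _ _ (measurableSet_singleton n), mul_comm]

/-! ### The sampled count is unbiased -/

/-- Counting by classes: `t` indexes a partition of `s` when every element of `s` is related to
exactly one index. -/
lemma ncard_eq_sum_ncard_of_existsUnique {α β : Type*} {s : Set α} (hs : s.Finite) (t : Finset β)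
    (R : α → β → Prop) (h : ∀ a ∈ s, ∃! b, b ∈ t ∧ R a b) :
    s.ncard = ∑ b ∈ t, {a ∈ s | R a b}.ncard := by
  classical
  lift s to Finset α using hs
  have hfib : ∀ b, {a ∈ (s : Set α) | R a b} = ↑(s.filter fun a => R a b) := fun b => by
    ext a; simp
  have hone : ∀ a ∈ s, (t.filter fun b => R a b).card = 1 := fun a ha =>
    Finset.card_eq_one_iff_existsUnique.2 (by simpa using h a (by simpa using ha))
  simp only [hfib, Set.ncard_coe_finset]
  calc s.card = ∑ a ∈ s, (t.filter fun b => R a b).card := by simp [Finset.sum_congr rfl hone]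
    _ = _ := Finset.sum_card_bipartiteAbove_eq_sum_card_bipartiteBelow R

namespace NSScheme

variable {V W : Type*} {G : SimpleGraph V} {P : SimpleGraph W} {kind : MatchKind}

/-- The number of matches whose path starts with the edge `e` and the vertices `l` and then has
exactly `r` further vertices. -/
noncomputable def extensions (S : NSScheme G P kind) (e : Sym2 V) (r : ℕ) (l : List V) : ℕ :=
  {M ∈ patternMatches G P kind |
    S.first M = e ∧ ∃ l' : List V, l'.length = r ∧ S.rest M = l ++ l'}.ncard

lemma extensions_zero (S : NSScheme G P kind) (e : Sym2 V) (l : List V) :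
    S.extensions e 0 l = S.hits e l := by
  simp [extensions, hits]

/-- The next vertex on the path of a match is a candidate, so the matches that extend `(e, l)` are
divided among the candidates. -/
lemma extensions_succ [Finite V] (S : NSScheme G P kind) (e : Sym2 V) (r : ℕ) (l : List V) :
    S.extensions e (r + 1) l = ∑ v ∈ S.cand e l, S.extensions e r (l ++ [v]) := by
  rw [extensions, ncard_eq_sum_ncard_of_existsUnique (Set.toFinite _) (S.cand e l)
    fun M v => ∃ l', S.rest M = l ++ v :: l']
  · refine Finset.sum_congr rfl fun v _ => congrArg Set.ncard ?_
    ext M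
    simp only [Set.mem_ofPred_eq, List.append_assoc, List.singleton_append]
    constructor
    · rintro ⟨⟨hM, he, l₁, hl₁, h₁⟩, l₂, h₂⟩
      refine ⟨hM, he, l₂, ?_, h₂⟩
      have := congrArg List.length (List.append_cancel_left (h₁.symm.trans h₂))
      simp only [List.length_cons] at this
      omega
    · rintro ⟨hM, he, l', hl', h⟩
      exact ⟨⟨hM, he, v :: l', by simp [hl'], h⟩, l', h⟩
  · rintro M ⟨hM, he, l₁, hl₁, h₁⟩
    obtain ⟨v, l', rfl⟩ := List.exists_cons_of_length_eq_add_one hl₁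
    refine ⟨v, ⟨he ▸ S.mem_cand M hM l v l' h₁, l', h₁⟩, ?_⟩
    rintro w ⟨_, l₂, h₂⟩
    exact (List.cons.inj (List.append_cancel_left (h₂.symm.trans h₁))).1

/-- The paths of all matches start with an edge of `G` and have `Nat.card W - 2` further
vertices. -/
lemma sum_extensions_nil [Finite V] (S : NSScheme G P kind) :
    ∑ e ∈ G.edgeSet.toFinite.toFinset, S.extensions e (Nat.card W - 2) [] =
      trueCount G P kind := by
  rw [trueCount, ncard_eq_sum_ncard_of_existsUnique (Set.toFinite _) G.edgeSet.toFinite.toFinset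
    fun M e => S.first M = e]
  · refine Finset.sum_congr rfl fun e _ => congrArg Set.ncard ?_
    ext M
    simp only [Set.mem_ofPred_eq, List.nil_append]
    constructor
    · rintro ⟨hM, he, -⟩
      exact ⟨hM, he⟩
    · rintro ⟨hM, he⟩
      exact ⟨hM, he, _, S.rest_length M hM, rfl⟩
  · intro M hM
    exact ⟨S.first M, ⟨by simpa using M.edgeSet_subset (S.first_mem M hM), rfl⟩,
      fun e he => he.2.symm⟩

lemma natMean_drawRest [Finite V] (S : NSScheme G P kind) (e : Sym2 V) (r : ℕ) (l : List V)
    (α : ℕ) : (S.drawRest e r l α).natMean = ((α * S.extensions e r l : ℕ) : ENNReal) := by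
  induction r generalizing l α with
  | zero => rw [drawRest, PMF.natMean_pure, extensions_zero]
  | succ r ih =>
    rw [extensions_succ, drawRest]
    split_ifs with h
    · exact PMF.natMean_uniformOfFinset_bind _ h _ α _ fun v _ => ih _ _
    · rw [PMF.natMean_pure, Finset.not_nonempty_iff_eq_empty.1 h]
      simp

lemma natMean_draw [Finite V] (S : NSScheme G P kind) :
    S.draw.natMean = (trueCount G P kind : ENNReal) := by
  rw [← S.sum_extensions_nil, draw]
  split_ifs with h
  · rw [PMF.natMean_uniformOfFinset_bind _ h _ 1 (fun e => S.extensions e (Nat.card W - 2) [])]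
    · simp
    · intro e _
      rw [natMean_drawRest, one_mul]
  · rw [PMF.natMean_pure, Finset.not_nonempty_iff_eq_empty.1 h]
    simp

end NSScheme

/-! ### Quantiles of the standard normal distribution -/

lemma continuous_cdf (μ : Measure ℝ) [IsProbabilityMeasure μ] [NullSingletonClass μ] :
    Continuous (cdf μ) := by
  refine continuous_iff_continuousAt.2 fun a => ?_
  rw [(monotone_cdf μ).continuousAt_iff_leftLim_eq_rightLim, StieltjesFunction.rightLim_eq]
  refine le_antisymm ((monotone_cdf μ).leftLim_le le_rfl) ?_
  have h := (cdf μ).measure_singleton a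
  rw [measure_cdf, measure_singleton] at h
  linarith [ENNReal.ofReal_eq_zero.1 h.symm]

instance nullSingletonClass_stdGaussian : NullSingletonClass (gaussianReal 0 1) :=
  nullSingletonClass_gaussianReal one_ne_zero

lemma stdNormalCDF_stdNormalInv {p : ℝ} (h0 : 0 < p) (h1 : p < 1) :
    stdNormalCDF (stdNormalInv p) = p := by
  refine Function.invFun_eq (mem_range_of_exists_le_of_exists_ge
    (continuous_cdf (gaussianReal 0 1)) ?_ ?_)
  · exact ((tendsto_cdf_atBot _).eventually_le_const h0).exists
  · exact ((tendsto_cdf_atTop _).eventually_const_le h1).exists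

lemma stdNormalCDF_eq (x : ℝ) : stdNormalCDF x = (gaussianReal 0 1).real (Set.Iic x) :=
  cdf_eq_real _ _

lemma stdNormalCDF_neg (x : ℝ) : stdNormalCDF (-x) = 1 - stdNormalCDF x := by
  have hneg : (gaussianReal 0 1).map (fun y => -y) = gaussianReal 0 1 := by
    rw [gaussianReal_map_neg, neg_zero]
  have h : (gaussianReal 0 1).real (Set.Iic (-x)) = (gaussianReal 0 1).real (Set.Ici x) := by
    conv_lhs => rw [← hneg]
    rw [map_measureReal_apply measurable_neg measurableSet_Iic]
    congr 1
    ext y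
    simp
  rw [stdNormalCDF_eq, stdNormalCDF_eq, h, ← measureReal_congr (Ioi_ae_eq_Ici (a := x)),
    ← Set.compl_Iic, probReal_compl_eq_one_sub measurableSet_Iic]

lemma gaussianReal_real_abs_lt_stdNormalInv {δ : ℝ} (hδ0 : 0 < δ) (hδ1 : δ < 1) :
    (gaussianReal 0 1).real {x | |x| < stdNormalInv (1 - δ / 2)} = 1 - δ := by
  have hz := stdNormalCDF_stdNormalInv (p := 1 - δ / 2) (by linarith) (by linarith)
  set z := stdNormalInv (1 - δ / 2)
  have hneg := stdNormalCDF_neg z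
  have hle : -z ≤ z := by
    -- otherwise `Φ z ≤ Φ (-z) = 1 - Φ z`, although `Φ z > 1 / 2`
    by_contra! h
    have := monotone_cdf (gaussianReal 0 1) h.le
    change stdNormalCDF z ≤ stdNormalCDF (-z) at this
    linarith
  have hset : {x : ℝ | |x| < z} = Set.Ioo (-z) z := by
    ext x
    simp [abs_lt]
  rw [hset, measureReal_congr (Ioo_ae_eq_Ioc (a := -z) (b := z)), ← Set.Iic_sdiff_Iic,
    measureReal_sdiff (Set.Iic_subset_Iic.2 hle) measurableSet_Iic, ← stdNormalCDF_eq,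
    ← stdNormalCDF_eq, hneg, hz]
  ring

/-! ### Asymptotic coverage -/

/-- The empirical variance of the first `n` terms, normalized by `1 / n`; the estimated standard
deviation `sampleSigma` of the mean is `√(empiricalVariance x n / n)`. -/
noncomputable def empiricalVariance (x : ℕ → ℝ) (n : ℕ) : ℝ :=
  (1 / (n : ℝ)) * ∑ i ∈ Finset.range n, x i ^ 2 - sampleMean x n ^ 2

/-- The event that the relative error is below the predicted one, with denominators cleared. If the
sample mean is `0`, then so are all terms and the empirical variance, and both sides are false. -/
lemma relError_lt_predictedError_iff {x : ℕ → ℝ} (hx : ∀ i, 0 ≤ x i) {C δ : ℝ} (hC : 0 < C)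
    {n : ℕ} (hn : n ≠ 0) :
    |sampleMean x n - C| / C < predictedError δ x n ↔
      |(√n)⁻¹ * (∑ i ∈ Finset.range n, x i - n * C)| * sampleMean x n
        - stdNormalInv (1 - δ / 2) * C * √(empiricalVariance x n) < 0 := by
  have hn' : (0 : ℝ) < n := by exact_mod_cast Nat.pos_of_ne_zero hn
  have hs : (0 : ℝ) < √n := Real.sqrt_pos.2 hn'
  have hmul : |(√n)⁻¹ * (∑ i ∈ Finset.range n, x i - n * C)| = √n * |sampleMean x n - C| := by
    rw [← abs_of_pos hs, ← abs_mul, abs_of_pos hs, sampleMean]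
    congr 1
    field_simp
    rw [Real.sq_sqrt hn'.le]
  have hsig : sampleSigma x n = √(empiricalVariance x n) / √n := by
    rw [sampleSigma, Real.sqrt_mul (by positivity), Real.sqrt_div zero_le_one, Real.sqrt_one]
    rw [empiricalVariance]
    ring
  have hm : 0 ≤ sampleMean x n :=
    mul_nonneg (by positivity) (Finset.sum_nonneg fun i _ => hx i)
  rw [hmul, predictedError, hsig]
  obtain hm | hm := hm.eq_or_lt
  · have hsum : ∑ i ∈ Finset.range n, x i = 0 := by
      simpa [sampleMean, hn] using hm.symm
    have hzero := (Finset.sum_eq_zero_iff_of_nonneg fun i _ => hx i).1 hsum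
    have hv : empiricalVariance x n = 0 := by
      rw [empiricalVariance, ← hm, Finset.sum_eq_zero fun i hi => by rw [hzero i hi]; simp]
      simp
    rw [hv, ← hm]
    simp only [zero_sub, abs_neg, abs_of_pos hC, div_self hC.ne', div_zero, Real.sqrt_zero,
      mul_zero, sub_zero, lt_self_iff_false, iff_false, not_lt]
    exact zero_le_one
  · rw [div_lt_div_iff₀ hC hm, mul_div_assoc', div_mul_eq_mul_div, lt_div_iff₀ hs, sub_neg]
    constructor <;> intro h <;> linarith

/-- The confidence interval is asymptotically exact for nonnegative i.i.d. random variables with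
positive variance. -/
lemma tendsto_measureReal_relError_lt {Ω : Type*} [MeasurableSpace Ω] {Pr : Measure Ω}
    [IsProbabilityMeasure Pr] {Y : ℕ → Ω → ℝ} (hY : ∀ i ω, 0 ≤ Y i ω) (hindep : iIndepFun Y Pr)
    (hident : ∀ i, IdentDistrib (Y i) (Y 0) Pr Pr) (hvar : 0 < Var[Y 0; Pr])
    {δ : ℝ} (hδ0 : 0 < δ) (hδ1 : δ < 1) :
    Tendsto (fun n : ℕ => Pr.real {ω | |sampleMean (fun i => Y i ω) n - Pr[Y 0]| / Pr[Y 0] <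
      predictedError δ (fun i => Y i ω) n}) atTop (𝓝 (1 - δ)) := by
  have hmeas i : AEMeasurable (Y i) Pr := (hident i).aemeasurable_fst
  -- `Var` takes the value `0` where the second moment is infinite
  have hL2 : MemLp (Y 0) 2 Pr :=
    memLp_two_of_variance_ne_zero (hmeas 0).aestronglyMeasurable hvar.ne'
  have hint : Integrable (Y 0) Pr := hL2.integrable (by norm_num)
  have hC : 0 < Pr[Y 0] := by
    refine (integral_nonneg (hY 0)).lt_of_ne' fun h => hvar.ne' ?_
    have h0 := (integral_eq_zero_iff_of_nonneg (hY 0) hint).1 h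
    rw [variance_congr h0, variance_zero]
  set C := Pr[Y 0] with hCdef
  set s := √Var[Y 0; Pr] with hs
  have hs0 : 0 < s := Real.sqrt_pos.2 hvar
  set z := stdNormalInv (1 - δ / 2)
  -- consistency of the sample mean and of the empirical variance
  have hmean : ∀ᵐ ω ∂Pr, Tendsto (fun n => sampleMean (fun i => Y i ω) n) atTop (𝓝 C) := by
    filter_upwards [strong_law_ae_real Y hint (fun i j hij => hindep.indepFun hij) hident]
      with ω hω
    simpa [sampleMean, div_eq_inv_mul] using hω
  have hsq : ∀ᵐ ω ∂Pr, Tendsto (fun n : ℕ => (1 / (n : ℝ)) * ∑ i ∈ Finset.range n, Y i ω ^ 2)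
      atTop (𝓝 (Pr[Y 0 ^ 2])) := by
    have hident2 i : IdentDistrib (fun ω => Y i ω ^ 2) (fun ω => Y 0 ω ^ 2) Pr Pr :=
      (hident i).comp (u := fun x : ℝ => x ^ 2) (by fun_prop)
    have hindep2 : iIndepFun (fun i ω => Y i ω ^ 2) Pr :=
      hindep.comp (fun _ x => x ^ 2) (by fun_prop)
    filter_upwards [strong_law_ae_real (fun i ω => Y i ω ^ 2) hL2.integrable_sq
      (fun i j hij => hindep2.indepFun hij) hident2] with ω hω
    simpa [div_eq_inv_mul] using hω
  have hest : ∀ᵐ ω ∂Pr, Tendsto (fun n => (sampleMean (fun i => Y i ω) n,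
      √(empiricalVariance (fun i => Y i ω) n))) atTop (𝓝 (C, s)) := by
    filter_upwards [hmean, hsq] with ω h1 h2
    refine h1.prodMk_nhds ?_
    rw [hs, variance_eq_sub hL2]
    exact (Real.continuous_sqrt.tendsto _).comp (h2.sub (h1.pow 2))
  have hest_meas n : AEMeasurable (fun ω => (sampleMean (fun i => Y i ω) n,
      √(empiricalVariance (fun i => Y i ω) n))) Pr := by
    unfold empiricalVariance sampleMean
    fun_prop
  -- the limit of the central limit theorem, realized as a multiple of a standard normal variable
  have hlaw : HasLaw (fun x : ℝ => s * x) (gaussianReal 0 Var[Y 0; Pr].toNNReal)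
      (gaussianReal 0 1) := by
    refine ⟨by fun_prop, ?_⟩
    rw [gaussianReal_map_const_mul, mul_zero]
    congr 1
    ext
    simp [hs, Real.sq_sqrt hvar.le, hvar.le]
  have hclt := tendstoInDistribution_inv_sqrt_mul_sum_sub hlaw hL2 hindep hident
  have hD := hclt.continuous_comp_prodMk_of_tendstoInMeasure_const
    (g := fun q : ℝ × ℝ × ℝ => |q.1| * q.2.1 - z * C * q.2.2) (by fun_prop)
    (tendstoInMeasure_of_tendsto_ae (fun n => (hest_meas n).aestronglyMeasurable) hest) hest_meas
  have hlim_neg (x : ℝ) : |s * x| * C - z * C * s < 0 ↔ |x| < z := by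
    rw [abs_mul, abs_of_pos hs0, show s * |x| * C - z * C * s = (s * C) * (|x| - z) by ring,
      ← not_le,
      mul_nonneg_iff_of_pos_left (by positivity), sub_nonneg, not_le]
  have hlim_zero (x : ℝ) : |s * x| * C - z * C * s = 0 ↔ |x| = z := by
    rw [abs_mul, abs_of_pos hs0, show s * |x| * C - z * C * s = (s * C) * (|x| - z) by ring,
      mul_eq_zero_iff_left (by positivity), sub_eq_zero]
  have hmeas_lim : Measurable fun x : ℝ => |s * x| * C - z * C * s := by fun_prop
  -- the boundary of the limiting event is `{z, -z}`, a null set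
  have hport := ProbabilityMeasure.tendsto_measure_of_null_frontier_of_tendsto' hD.tendsto
    (E := Set.Iio 0) (by
      rw [frontier_Iio, ProbabilityMeasure.coe_mk,
        Measure.map_apply hmeas_lim (measurableSet_singleton 0)]
      refine ((Set.toFinite {z, -z}).subset fun x hx => ?_).measure_zero _
      exact eq_or_eq_neg_of_abs_eq ((hlim_zero x).1 hx))
  simp only [ProbabilityMeasure.coe_mk] at hport
  have := Measure.isProbabilityMeasure_map (μ := gaussianReal 0 1) hmeas_lim.aemeasurable
  have hreal := (ENNReal.tendsto_toReal (measure_ne_top _ _)).comp hport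
  have hval : ((gaussianReal 0 1).map (fun x => |s * x| * C - z * C * s)).real (Set.Iio 0) =
      1 - δ := by
    rw [map_measureReal_apply hmeas_lim measurableSet_Iio,
      ← gaussianReal_real_abs_lt_stdNormalInv hδ0 hδ1]
    congr 1
    ext x
    exact hlim_neg x
  change Tendsto _ _ (𝓝 (Measure.real _ _)) at hreal
  rw [hval] at hreal
  refine hreal.congr' ?_
  filter_upwards [eventually_ne_atTop 0] with n hn
  change Measure.real (Measure.map _ _) _ = _
  rw [map_measureReal_apply_of_aemeasurable (hD.forall_aemeasurable n) measurableSet_Iio]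
  congr 1
  ext ω
  exact (relError_lt_predictedError_iff (fun i => hY i ω) hC hn).symm

theorem theorem1 {V W Ω : Type*} [Finite V] [Finite W]
    (G : SimpleGraph V) (P : SimpleGraph W) (kind : MatchKind) (S : NSScheme G P kind)
    [MeasurableSpace Ω] (Pr : Measure Ω) [IsProbabilityMeasure Pr]
    (X : ℕ → Ω → ℕ)
    (hlaw : ∀ i, HasLaw (X i) S.draw.toMeasure Pr)
    (hindep : iIndepFun X Pr)
    (hvar : 0 < Var[fun ω => (X 0 ω : ℝ); Pr])
    (δ : ℝ) (hδ0 : 0 < δ) (hδ1 : δ < 1) :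
    Tendsto
      (fun n : ℕ => Pr.real {ω | |sampleMean (fun i => (X i ω : ℝ)) n - (trueCount G P kind : ℝ)|
        / (trueCount G P kind : ℝ) < predictedError δ (fun i => (X i ω : ℝ)) n})
      atTop (𝓝 (1 - δ)) := by
  have hmeas i : AEMeasurable (X i) Pr := (hlaw i).aemeasurable
  have hmean : ∫ ω, (X 0 ω : ℝ) ∂Pr = trueCount G P kind := by
    rw [integral_eq_lintegral_of_nonneg_ae (ae_of_all _ fun ω => Nat.cast_nonneg _)
      ((measurable_from_nat (f := fun n : ℕ => (n : ℝ))).comp_aemeasurable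
        (hmeas 0)).aestronglyMeasurable]
    simp only [ENNReal.ofReal_natCast]
    rw [lintegral_natCast_eq_natMean (hlaw 0), S.natMean_draw, ENNReal.toReal_natCast]
  have h := tendsto_measureReal_relError_lt (Y := fun i ω => (X i ω : ℝ))
    (fun i ω => Nat.cast_nonneg _)
    (hindep.comp (fun _ n => (n : ℝ)) fun _ => measurable_from_nat)
    (fun i => ((hlaw i).identDistrib (hlaw 0)).comp
      (u := fun n : ℕ => (n : ℝ)) measurable_from_nat) hvar hδ0 hδ1
  rwa [hmean] at h
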